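/- Let $k$ be a field, $R=k[x_1,\ldots,x_n]$, $\mathfrak m=(x_1,\ldots,x_n)$, and let $I\subsetneq R$ be a proper ideal (not necessarily homogeneous). For an $R$-module $M$ put $\operatorname{depth} M=\min\{d\ge 0 \mid \operatorname{Ext}^d_R(R/\mathfrak m,M)\neq 0\}$, with $\operatorname{depth} M=\infty$ if all these Ext modules vanish. For a term order $>$ and an ideal $J\subseteq R$ let $\operatorname{in}_>(J)$ be the ideal generated by the leading terms of the elements of $J$. An element $f$ is called regular on $M$ if $f\in\mathfrak m$ and $f$ is a non-zerodivisor on $M$. Let $>_1,\ldots,>_q$ be term orders on $R$. A sequence of nonconstant polynomials $f_1,\ldots,f_q\in R$ is called an initially regular sequence on $R/I$ with respect to $>_1,\ldots,>_q$ if, for each $i=1,\ldots,q$, $f_i$ is a regular element on $R/I_i$, where $I_1=\operatorname{in}_{>_1}(I)$ and $I_i=\operatorname{in}_{>_i}(I_{i-1},f_{i-1})$ for $2\le i\le q$. If $f_1,\ldots,f_q$ is an initially regular sequence on $R/I$ with respect to $>_1,\ldots,>_q$, then $\operatorname{depth} R/I\ge q$. -/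

import Mathlib

universe u v

open CategoryTheory in
/-- The depth `min {d | Ext^d_A(A/𝔪, M) ≠ 0}` of an `A`-module `M` with respect to an ideal `𝔪`
of `A`. It is an element of `ℕ∞`, equal to `⊤` if all the Ext modules vanish. -/
noncomputable def moduleDepth {A : Type u} [CommRing A] (𝔪 : Ideal A)
    (M : Type u) [AddCommGroup M] [Module A M] : ℕ∞ :=
  sInf {e : ℕ∞ | ∃ d : ℕ, e = d ∧
    Nontrivial (Abelian.Ext.{u} (ModuleCat.of A (A ⧸ 𝔪)) (ModuleCat.of A M) d)}

namespace InitiallyRegular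

open MvPolynomial

variable {k : Type u} [Field k] {n : ℕ}

/-- The initial ideal of `I` for a term order: the ideal generated by the leading terms of all
elements of `I` (the leading term of `0` is `0`). -/
noncomputable def ini (ord : MonomialOrder.{0, v} (Fin n)) (I : Ideal (MvPolynomial (Fin n) k)) :
    Ideal (MvPolynomial (Fin n) k) :=
  Ideal.span (ord.leadingTerm '' (I : Set (MvPolynomial (Fin n) k)))

/-- `f` is a regular element on the module `M`, i.e. a regular sequence of length one: as for all
regular sequences in the definition of depth, it is required to lie in the maximal homogeneous
ideal `(x₁, …, xₙ)`, and it is a non-zerodivisor on `M`. -/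
def IsRegularElement (f : MvPolynomial (Fin n) k) (M : Type u) [AddCommGroup M]
    [Module (MvPolynomial (Fin n) k) M] : Prop :=
  f ∈ idealOfVars (Fin n) k ∧ IsSMulRegular M f

/-- The ideals attached to `I`, the term orders and the polynomials `f`, with indices shifted to
start at `0`: the first one is the initial ideal of `I` for the first order, and the `(i + 1)`-st
one is the initial ideal, for the `(i + 1)`-st order, of the ideal generated by the `i`-th one
and `f i`. -/
noncomputable def iniSeq {q : ℕ} (I : Ideal (MvPolynomial (Fin n) k))
    (ord : Fin q → MonomialOrder.{0, v} (Fin n)) (f : Fin q → MvPolynomial (Fin n) k) :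
    (i : ℕ) → i < q → Ideal (MvPolynomial (Fin n) k)
  | 0, h => ini (ord ⟨0, h⟩) I
  | i + 1, h => ini (ord ⟨i + 1, h⟩)
      (iniSeq I ord f i (Nat.lt_of_succ_lt h) ⊔ Ideal.span {f ⟨i, Nat.lt_of_succ_lt h⟩})

/-- `f` is an initially regular sequence on `k[x₁, …, xₙ] / I` with respect to the sequence `ord`
of term orders. -/
structure IsInitiallyRegular {q : ℕ} (I : Ideal (MvPolynomial (Fin n) k))
    (ord : Fin q → MonomialOrder.{0, v} (Fin n)) (f : Fin q → MvPolynomial (Fin n) k) : Prop where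
  proper : I ≠ ⊤
  nonconstant : ∀ i, ∀ c : k, f i ≠ C c
  regular : ∀ i : Fin q,
    IsRegularElement (f i) (MvPolynomial (Fin n) k ⧸ iniSeq I ord f i i.isLt)

end InitiallyRegular

/-! Depth is detected by the Koszul cohomology `H^i` of `x₁, …, xₙ`: if `H^i(M) = 0`, then
`Ext^i(R/𝔪, M) = 0` (`subsingleton_ext_of_isAcyclic`). This follows by embedding `M` in an injective
module and shifting dimension, since injectives have no Koszul cohomology in positive degrees.

Two facts drive the vanishing. If `f ∈ 𝔪` is a nonzerodivisor on `R/J`, then `H^(i-1)(R/(J, f)) = 0`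
gives `H^i(R/J) = 0`, because `f` acts null-homotopically (`isAcyclic_quotient_of_regular`). And
`H^i(R/in(J)) = 0` gives `H^i(R/J) = 0`: the Koszul differential is multihomogeneous, so a cocycle
modulo `J` can be corrected one leading part at a time (`isAcyclic_of_ini`).

Alternating the two along the sequence, with indices from `0`, gives `H^j(R/I_i) = 0` whenever `i +
j < q`. The case `i = 0` and one more passage from `in(I)` to `I` finish the proof. -/

namespace Koszul

open Finset

/-! ### Koszul cochains and their operators -/

section Support

variable {σ : Type*} (R : Type*) [CommRing R] (M : Type*) [AddCommGroup M] [Module R M]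

/-- The Koszul cochains supported on subsets of `A` with property `P` on their cardinality. -/
def supp (A : Finset σ) (P : ℕ → Prop) : Submodule R (Finset σ → M) where
  carrier := {z | ∀ S, ¬ (S ⊆ A ∧ P #S) → z S = 0}
  zero_mem' := fun _ _ => rfl
  add_mem' hz hw S hS := by simp [hz S hS, hw S hS]
  smul_mem' c z hz S hS := by simp [hz S hS]

variable {R M}

lemma supp_mono {A B : Finset σ} {P Q : ℕ → Prop} {z : Finset σ → M}
    (hz : z ∈ supp R M A P) (hB : A ⊆ B) (hPQ : ∀ i, P i → Q i) : z ∈ supp R M B Q :=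
  fun S hS => hz S fun h => hS ⟨h.1.trans hB, hPQ _ h.2⟩

end Support

section Operators

variable {σ : Type*} [LinearOrder σ] (R : Type*) [CommRing R]

/-- The sign `(-1) ^ #{t ∈ T | t < j}` of the Koszul complex. -/
def sgn (j : σ) (T : Finset σ) : R := (-1) ^ #{t ∈ T | t < j}

variable {R}

lemma sgn_mul_self (j : σ) (T : Finset σ) : sgn R j T * sgn R j T = 1 := by
  rw [sgn, ← mul_pow]
  simp

lemma sgn_insert_of_lt {i j : σ} {T : Finset σ} (hi : i ∉ T) (h : i < j) :
    sgn R j (insert i T) = -sgn R j T := by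
  rw [sgn, sgn, filter_insert, if_pos h, card_insert_of_notMem (by simp [hi]), pow_succ]
  ring

lemma sgn_insert_of_le {i j : σ} {T : Finset σ} (h : j ≤ i) :
    sgn R j (insert i T) = sgn R j T := by
  rw [sgn, sgn, filter_insert, if_neg h.not_gt]

lemma sgn_mul_sgn_insert {i j : σ} {T : Finset σ} (hi : i ∉ T) (hj : j ∉ T) (hij : i ≠ j) :
    sgn R i (insert j T) * sgn R j T = -(sgn R j (insert i T) * sgn R i T) := by
  rcases hij.lt_or_gt with h | h
  · rw [sgn_insert_of_lt hi h, sgn_insert_of_le h.le]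
    ring
  · rw [sgn_insert_of_lt hj h, sgn_insert_of_le h.le]
    ring

variable (R) (M : Type*) [AddCommGroup M] [Module R M]

/-- Exterior multiplication by the `j`-th basis vector on Koszul cochains. -/
def wedge (j : σ) : (Finset σ → M) →ₗ[R] (Finset σ → M) where
  toFun z T := if j ∈ T then sgn R j (T.erase j) • z (T.erase j) else 0
  map_add' z w := by
    ext T
    by_cases h : j ∈ T <;> simp [h]
  map_smul' c z := by
    ext T
    by_cases h : j ∈ T <;> simp [h, smul_comm c]

/-- Contraction with the `j`-th dual basis vector on Koszul cochains. -/
def contr (j : σ) : (Finset σ → M) →ₗ[R] (Finset σ → M) where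
  toFun z T := if j ∈ T then 0 else sgn R j T • z (insert j T)
  map_add' z w := by
    ext T
    by_cases h : j ∈ T <;> simp [h]
  map_smul' c z := by
    ext T
    by_cases h : j ∈ T <;> simp [h, smul_comm c]

variable {R M}

lemma wedge_apply (j : σ) (z : Finset σ → M) (T : Finset σ) :
    wedge R M j z T = if j ∈ T then sgn R j (T.erase j) • z (T.erase j) else 0 := rfl

lemma wedge_apply_insert {j : σ} (z : Finset σ → M) {T : Finset σ} (h : j ∉ T) :
    wedge R M j z (insert j T) = sgn R j T • z T := by
  simp [wedge_apply, h]

lemma wedge_apply_of_notMem {j : σ} (z : Finset σ → M) {T : Finset σ} (h : j ∉ T) :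
    wedge R M j z T = 0 := by
  simp [wedge_apply, h]

lemma contr_apply_of_notMem {j : σ} (z : Finset σ → M) {T : Finset σ} (h : j ∉ T) :
    contr R M j z T = sgn R j T • z (insert j T) := by
  simp [contr, h]

lemma contr_apply_of_mem {j : σ} (z : Finset σ → M) {T : Finset σ} (h : j ∈ T) :
    contr R M j z T = 0 := by
  simp [contr, h]

lemma wedge_wedge_self (j : σ) (z : Finset σ → M) : wedge R M j (wedge R M j z) = 0 := by
  ext T
  by_cases h : j ∈ T
  · simp [wedge_apply, h]
  · simp [wedge_apply, h]

lemma wedge_wedge {i j : σ} (hij : i ≠ j) (z : Finset σ → M) :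
    wedge R M i (wedge R M j z) = -wedge R M j (wedge R M i z) := by
  ext T
  by_cases hi : i ∈ T
  swap
  · simp [wedge_apply, hi]
  by_cases hj : j ∈ T
  swap
  · simp [wedge_apply, hj]
  obtain ⟨U, hiU, rfl⟩ : ∃ U, i ∉ U ∧ T = insert i U :=
    ⟨T.erase i, notMem_erase _ _, (insert_erase hi).symm⟩
  replace hj : j ∈ U := mem_of_mem_insert_of_ne hj hij.symm
  obtain ⟨T, hjT, rfl⟩ : ∃ T, j ∉ T ∧ U = insert j T :=
    ⟨U.erase j, notMem_erase _ _, (insert_erase hj).symm⟩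
  have hi' : i ∉ T := fun h => hiU (mem_insert_of_mem h)
  have hj' : j ∉ insert i T := by simp [hij.symm, hjT]
  rw [wedge_apply_insert _ hiU, wedge_apply_insert _ hjT, Pi.neg_apply, insert_comm,
    wedge_apply_insert _ hj', wedge_apply_insert _ hi', smul_smul, smul_smul,
    sgn_mul_sgn_insert hi' hjT hij, neg_smul]

/-- At each `T` exactly one summand survives, according to whether `j ∈ T`, and its two equal signs
cancel. -/
lemma wedge_contr_add_self (j : σ) (z : Finset σ → M) :
    wedge R M j (contr R M j z) + contr R M j (wedge R M j z) = z := by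
  ext T
  by_cases h : j ∈ T
  · obtain ⟨T, hj, rfl⟩ : ∃ U, j ∉ U ∧ T = insert j U :=
      ⟨T.erase j, notMem_erase _ _, (insert_erase h).symm⟩
    rw [Pi.add_apply, wedge_apply_insert _ hj, contr_apply_of_notMem _ hj,
      contr_apply_of_mem _ h, smul_smul, sgn_mul_self, one_smul, add_zero]
  · rw [Pi.add_apply, wedge_apply_of_notMem _ h, contr_apply_of_notMem _ h,
      wedge_apply_insert _ h, smul_smul, sgn_mul_self, one_smul, zero_add]

lemma wedge_contr {i j : σ} (hij : i ≠ j) (z : Finset σ → M) :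
    wedge R M i (contr R M j z) = -contr R M j (wedge R M i z) := by
  ext T
  by_cases hj : j ∈ T
  · rw [Pi.neg_apply, contr_apply_of_mem _ hj, wedge_apply]
    split_ifs
    · rw [contr_apply_of_mem _ (mem_erase.2 ⟨hij.symm, hj⟩), smul_zero, neg_zero]
    · rw [neg_zero]
  by_cases hi : i ∈ T
  swap
  · rw [Pi.neg_apply, wedge_apply_of_notMem _ hi, contr_apply_of_notMem _ hj,
      wedge_apply_of_notMem _ (by simp [hij, hi]), smul_zero, neg_zero]
  obtain ⟨T, hiT, rfl⟩ : ∃ U, i ∉ U ∧ T = insert i U :=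
    ⟨T.erase i, notMem_erase _ _, (insert_erase hi).symm⟩
  have hj' : j ∉ T := fun h => hj (mem_insert_of_mem h)
  have hi' : i ∉ insert j T := by simp [hij, hiT]
  rw [Pi.neg_apply, wedge_apply_insert _ hiT, contr_apply_of_notMem _ hj',
    contr_apply_of_notMem _ hj, insert_comm, wedge_apply_insert _ hi', smul_smul, smul_smul,
    ← neg_smul]
  congr 1
  have h := sgn_mul_sgn_insert (R := R) hiT hj' hij
  have h₁ := sgn_mul_self (R := R) j T
  have h₂ := sgn_mul_self (R := R) j (insert i T)
  linear_combination (sgn R j (insert i T) * sgn R j T) * h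
    - sgn R i (insert j T) * sgn R j (insert i T) * h₁ - sgn R i T * sgn R j T * h₂

variable (M) (x : σ → R)

/-- The Koszul differential for the elements `x j` with `j ∈ A`. -/
def diff (A : Finset σ) : (Finset σ → M) →ₗ[R] (Finset σ → M) :=
  ∑ j ∈ A, x j • wedge R M j

variable {M x}

lemma diff_apply (A : Finset σ) (z : Finset σ → M) :
    diff M x A z = ∑ j ∈ A, x j • wedge R M j z := by
  simp [diff]

lemma diff_insert {a : σ} {A : Finset σ} (h : a ∉ A) (z : Finset σ → M) :
    diff M x (insert a A) z = x a • wedge R M a z + diff M x A z := by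
  rw [diff_apply, diff_apply, sum_insert h]

lemma diff_wedge {a : σ} {A : Finset σ} (h : a ∉ A) (z : Finset σ → M) :
    diff M x A (wedge R M a z) = -wedge R M a (diff M x A z) := by
  rw [diff_apply, diff_apply, map_sum, ← sum_neg_distrib]
  refine sum_congr rfl fun j hj => ?_
  rw [wedge_wedge (ne_of_mem_of_not_mem hj h), map_smul, smul_neg]

lemma diff_contr {a : σ} {A : Finset σ} (h : a ∉ A) (z : Finset σ → M) :
    diff M x A (contr R M a z) = -contr R M a (diff M x A z) := by
  rw [diff_apply, diff_apply, map_sum, ← sum_neg_distrib]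
  refine sum_congr rfl fun j hj => ?_
  rw [wedge_contr (ne_of_mem_of_not_mem hj h), map_smul, smul_neg]

lemma diff_diff (A : Finset σ) (z : Finset σ → M) : diff M x A (diff M x A z) = 0 := by
  induction A using Finset.induction_on generalizing z with
  | empty => simp [diff]
  | insert a A ha ih =>
    rw [diff_insert ha, diff_insert ha, map_add, map_add, map_smul, map_smul, ih, diff_wedge ha,
      wedge_wedge_self]
    simp

/-- Contraction along `a` anticommutes with every summand of the differential except the one for
`a`. This is the source of the null-homotopy for elements of `(x)`. -/
lemma diff_contr_add {a : σ} {A : Finset σ} (h : a ∈ A) (z : Finset σ → M) :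
    diff M x A (contr R M a z) + contr R M a (diff M x A z) = x a • z := by
  obtain ⟨A, ha, rfl⟩ : ∃ B, a ∉ B ∧ A = insert a B :=
    ⟨A.erase a, notMem_erase _ _, (insert_erase h).symm⟩
  rw [diff_insert ha, diff_insert ha, diff_contr ha, map_add, map_smul]
  conv_rhs => rw [← wedge_contr_add_self (R := R) a z]
  rw [smul_add]
  abel

lemma wedge_comp {N : Type*} [AddCommGroup N] [Module R N] (φ : M →ₗ[R] N) (j : σ)
    (z : Finset σ → M) : wedge R N j (φ ∘ z) = φ ∘ wedge R M j z := by
  ext T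
  by_cases h : j ∈ T <;> simp [wedge_apply, h]

lemma diff_comp {N : Type*} [AddCommGroup N] [Module R N] (φ : M →ₗ[R] N) (A : Finset σ)
    (z : Finset σ → M) : diff N x A (φ ∘ z) = φ ∘ diff M x A z := by
  ext T
  simp [diff_apply, wedge_comp]

lemma wedge_mem_supp {a : σ} {A B : Finset σ} {P Q : ℕ → Prop} {z : Finset σ → M}
    (hz : z ∈ supp R M A P) (hB : insert a A ⊆ B) (hPQ : ∀ i, P i → Q (i + 1)) :
    wedge R M a z ∈ supp R M B Q := by
  intro S hS
  by_cases ha : a ∈ S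
  · obtain ⟨S, haS, rfl⟩ : ∃ B, a ∉ B ∧ S = insert a B :=
      ⟨S.erase a, notMem_erase _ _, (insert_erase ha).symm⟩
    rw [wedge_apply_insert _ haS, hz S, smul_zero]
    rintro ⟨h₁, h₂⟩
    exact hS ⟨(insert_subset_insert a h₁).trans hB, by
      rw [card_insert_of_notMem haS]; exact hPQ _ h₂⟩
  · exact wedge_apply_of_notMem _ ha

lemma contr_mem_supp {a : σ} {A : Finset σ} {P Q : ℕ → Prop} {z : Finset σ → M}
    (hz : z ∈ supp R M A P) (hPQ : ∀ i, P (i + 1) → Q i) :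
    contr R M a z ∈ supp R M (A.erase a) Q := by
  intro S hS
  by_cases ha : a ∈ S
  · exact contr_apply_of_mem _ ha
  · rw [contr_apply_of_notMem _ ha, hz _, smul_zero]
    rintro ⟨h₁, h₂⟩
    rw [card_insert_of_notMem ha] at h₂
    exact hS ⟨fun t ht => mem_erase.2 ⟨ne_of_mem_of_not_mem ht ha, h₁ (mem_insert_of_mem ht)⟩,
      hPQ _ h₂⟩

lemma diff_mem_supp {A : Finset σ} {P Q : ℕ → Prop} {z : Finset σ → M}
    (hz : z ∈ supp R M A P) (hPQ : ∀ i, P i → Q (i + 1)) : diff M x A z ∈ supp R M A Q := by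
  rw [diff_apply]
  exact Submodule.sum_mem _ fun j hj => Submodule.smul_mem _ _
    (wedge_mem_supp hz (insert_subset hj subset_rfl) hPQ)

lemma contr_eq_zero {a : σ} {A : Finset σ} {P : ℕ → Prop} {z : Finset σ → M}
    (hz : z ∈ supp R M A P) (ha : a ∉ A) : contr R M a z = 0 := by
  ext S
  by_cases h : a ∈ S
  · exact contr_apply_of_mem _ h
  · rw [contr_apply_of_notMem _ h, hz _ fun h' => ha (h'.1 (mem_insert_self _ _)), smul_zero]
    rfl

lemma diff_single {A : Finset σ} (u : M) (j : σ) :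
    diff M x A (Pi.single ∅ u) {j} = if j ∈ A then x j • u else 0 := by
  have h (i : σ) : wedge R M i (Pi.single ∅ u) {j} = if i = j then u else 0 := by
    by_cases hij : i = j
    · subst hij
      have := wedge_apply_insert (R := R) (j := i) (Pi.single ∅ u) (notMem_empty i)
      simpa [sgn] using this
    · simp [wedge_apply, hij]
  simp [diff_apply, h, sum_ite_eq']

lemma diff_single_eq_zero_iff {A : Finset σ} {u : M} :
    diff M x A (Pi.single ∅ u) = 0 ↔ ∀ j ∈ A, x j • u = 0 := by
  refine ⟨fun h j hj => ?_, fun h => ?_⟩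
  · simpa [diff_single, hj] using congrFun h {j}
  · rw [diff_apply]
    refine sum_eq_zero fun j hj => ?_
    rw [← map_smul, ← Pi.single_smul, h j hj, Pi.single_zero, map_zero]

lemma single_mem_supp (A : Finset σ) (u : M) :
    (Pi.single ∅ u : Finset σ → M) ∈ supp R M A (· = 0) := by
  intro S hS
  rw [Pi.single_eq_of_ne]
  rintro rfl
  simp at hS

lemma eq_single_of_mem_supp {A : Finset σ} {y : Finset σ → M}
    (hy : y ∈ supp R M A (· = 0)) : y = Pi.single ∅ (y ∅) := by
  ext S
  rcases S.eq_empty_or_nonempty with rfl | hS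
  · simp
  · rw [Pi.single_eq_of_ne hS.ne_empty, hy S (by simp [hS.ne_empty])]

/-- The Koszul complex of a module is acyclic in positive degrees if the elements `x` act, one
after the other, surjectively on the annihilators of the preceding ones. -/
theorem exists_diff_eq_of_surjective
    (hE : ∀ (A : Finset σ) (a : σ), a ∉ A → ∀ y : M, (∀ j ∈ A, x j • y = 0) →
      ∃ u : M, x a • u = y ∧ ∀ j ∈ A, x j • u = 0)
    (A : Finset σ) (i : ℕ) (z : Finset σ → M) (hz : z ∈ supp R M A (· = i + 1))
    (hd : diff M x A z = 0) : ∃ w ∈ supp R M A (· = i), diff M x A w = z := by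
  induction A using Finset.induction_on generalizing i z with
  | empty =>
    refine ⟨0, Submodule.zero_mem _, ?_⟩
    ext S
    rw [hz S, map_zero, Pi.zero_apply]
    rintro ⟨h₁, h₂⟩
    rw [subset_empty.1 h₁] at h₂
    simp at h₂
  | insert a A ha ih =>
    set z₁ := contr R M a z with hz₁
    have hz₁s : z₁ ∈ supp R M A (· = i) := by
      have := contr_mem_supp (a := a) hz (Q := (· = i)) (by simp)
      rwa [erase_insert ha] at this
    set z₀ := contr R M a (wedge R M a z) with hz₀
    have hz₀s : z₀ ∈ supp R M A (· = i + 1) := by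
      have := contr_mem_supp (a := a) (Q := (· = i + 1))
        (wedge_mem_supp (B := insert a A) (Q := (· = i + 2)) (a := a) hz (by simp) (by simp))
        (by simp)
      rwa [erase_insert ha] at this
    have hsum : wedge R M a z₁ + z₀ = z := wedge_contr_add_self a z
    have hd₀ : diff M x A z₀ = 0 := by
      rw [hz₀, diff_contr ha, diff_wedge ha, map_neg, neg_neg]
      have h := congrArg (fun y => contr R M a (wedge R M a y)) hd
      simpa [diff_insert ha, wedge_wedge_self] using h
    obtain ⟨w₀, hw₀, hdw₀⟩ := ih i z₀ hz₀s hd₀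
    -- Subtracting the coboundary of `w₀` removes `z₀` and leaves `e_a ∧ y`.
    set y := z₁ - x a • w₀ with hy
    have hys : y ∈ supp R M A (· = i) := Submodule.sub_mem _ hz₁s (Submodule.smul_mem _ _ hw₀)
    have hzy : z = diff M x (insert a A) w₀ + wedge R M a y := by
      rw [← hsum, ← hdw₀, diff_insert ha, hy, map_sub, map_smul]
      abel
    have hdy : diff M x A y = 0 := by
      have h : wedge R M a (diff M x A y) = 0 := by
        rw [hzy, map_add, diff_diff, diff_insert ha, wedge_wedge_self, diff_wedge ha] at hd
        simpa using hd
      have h' := wedge_contr_add_self (R := R) a (diff M x A y)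
      rw [h, map_zero, contr_eq_zero (diff_mem_supp hys (Q := fun _ => True) (by simp)) ha,
        map_zero, add_zero] at h'
      exact h'.symm
    suffices h : ∃ w ∈ supp R M (insert a A) (· = i),
        diff M x (insert a A) w = wedge R M a y by
      obtain ⟨w, hw, hw'⟩ := h
      exact ⟨w₀ + w, Submodule.add_mem _ (supp_mono hw₀ (subset_insert _ _) (by simp)) hw,
        by rw [map_add, hw', hzy]⟩
    -- In degree `0`, `y` is an element killed by `A`, and `hE` divides it by `x a`. In positive
    -- degree, `y` is a coboundary for `A` by induction.
    cases i with
    | zero =>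
      have hy' := eq_single_of_mem_supp hys
      obtain ⟨u, hu, hu'⟩ := hE A a ha (y ∅) (diff_single_eq_zero_iff.1 (hy' ▸ hdy))
      refine ⟨Pi.single ∅ u, single_mem_supp _ _, ?_⟩
      rw [diff_insert ha, diff_single_eq_zero_iff.2 hu', add_zero, hy', ← hu, ← map_smul,
        ← Pi.single_smul]
    | succ i =>
      obtain ⟨w, hw, hw'⟩ := ih i y hys hdy
      refine ⟨-wedge R M a w, Submodule.neg_mem _ (wedge_mem_supp hw subset_rfl (by simp)), ?_⟩
      rw [map_neg, diff_insert ha, wedge_wedge_self, diff_wedge ha, hw']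
      simp

end Operators

end Koszul

namespace Koszul

open Finset

/-! ### Lifting cochains and the long exact sequence -/

section Lift

variable {σ : Type*} [Fintype σ] {R E C : Type*} [CommRing R] [AddCommGroup E] [Module R E]
  [AddCommGroup C] [Module R C] {g : E →ₗ[R] C}

lemma exists_lift_mem_supp (hg : Function.Surjective g) {P : ℕ → Prop} {c : Finset σ → C}
    (hc : c ∈ supp R C univ P) : ∃ e ∈ supp R E univ P, g ∘ e = c := by
  -- Zero values are lifted to zero, so that the support is kept.
  have h (S : Finset σ) : ∃ e : E, g e = c S ∧ (c S = 0 → e = 0) := by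
    by_cases hS : c S = 0
    · exact ⟨0, by simp [hS]⟩
    · obtain ⟨e, he⟩ := hg (c S)
      exact ⟨e, he, fun h => absurd h hS⟩
  choose e he he' using h
  exact ⟨e, fun S hS => he' S (hc S hS), funext he⟩

end Lift

section Acyclic

variable {σ : Type*} [LinearOrder σ] [Fintype σ] {R : Type*} [CommRing R] (x : σ → R)

/-- The Koszul complex of the elements `x` on `M` has no cohomology in degree `i`. -/
def IsAcyclic (i : ℕ) (M : Type*) [AddCommGroup M] [Module R M] : Prop :=
  ∀ z ∈ supp R M univ (· = i), diff M x univ z = 0 →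
    ∃ w ∈ supp R M univ (· + 1 = i), diff M x univ w = z

variable {x} {M E C : Type*} [AddCommGroup M] [Module R M] [AddCommGroup E] [Module R E]
  [AddCommGroup C] [Module R C] {f : M →ₗ[R] E} {g : E →ₗ[R] C}

/-- Cocycles lift along a surjection if the kernel has no cohomology in the next degree. -/
lemma exists_cocycle_lift (hf : Function.Injective f) (hg : Function.Surjective g)
    (hfg : Function.Exact f g) {i : ℕ} (hM : IsAcyclic x (i + 1) M) {c : Finset σ → C}
    (hc : c ∈ supp R C univ (· = i)) (hd : diff C x univ c = 0) :
    ∃ e ∈ supp R E univ (· = i), diff E x univ e = 0 ∧ g ∘ e = c := by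
  obtain ⟨e, he, rfl⟩ := exists_lift_mem_supp hg hc
  rw [diff_comp] at hd
  have hde : diff E x univ e ∈ supp R E univ (· = i + 1) := diff_mem_supp he (by simp)
  have h (S : Finset σ) : ∃ m, f m = diff E x univ e S := (hfg _).1 (congrFun hd S)
  choose z hz using h
  replace hz : f ∘ z = diff E x univ e := funext hz
  obtain ⟨w, hw, rfl⟩ := hM z
    (fun S hS => hf (by rw [map_zero, ← hde S hS, ← hz]; rfl))
    (hf.comp_left (by simp [← diff_comp, hz, diff_diff]))
  refine ⟨e - f ∘ w, Submodule.sub_mem _ he fun S hS => ?_, ?_, ?_⟩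
  · rw [Function.comp_apply, hw S (by simpa using hS), map_zero]
  · rw [map_sub, diff_comp, hz, sub_self]
  · ext S
    simp [hfg.apply_apply_eq_zero]

/-- Exactness of `H^i(E) → H^i(C) → H^(i+1)(M)` in the middle. -/
lemma IsAcyclic.of_shortExact (hf : Function.Injective f) (hg : Function.Surjective g)
    (hfg : Function.Exact f g) {i : ℕ} (hM : IsAcyclic x (i + 1) M) (hE : IsAcyclic x i E) :
    IsAcyclic x i C := by
  intro c hc hd
  obtain ⟨e, he, hde, rfl⟩ := exists_cocycle_lift hf hg hfg hM hc hd
  obtain ⟨w, hw, rfl⟩ := hE e he hde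
  refine ⟨g ∘ w, fun S hS => ?_, diff_comp _ _ _⟩
  rw [Function.comp_apply, hw S hS, map_zero]

end Acyclic

section Hom

variable {σ R : Type*} [CommRing R] {x : σ → R} {M : Type*} [AddCommGroup M] [Module R M]

lemma smul_eq_zero_of_hom (φ : (R ⧸ Ideal.span (Set.range x)) →ₗ[R] M) (j : σ) : x j • φ 1 = 0 := by
  rw [← map_smul, ← map_zero φ]
  congr 1
  rw [Algebra.smul_def, mul_one]
  exact Ideal.Quotient.eq_zero_iff_mem.2 (Ideal.subset_span ⟨j, rfl⟩)

/-- A morphism out of `R / (x)` corresponds to an element annihilated by `x`. -/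
lemma exists_hom_of_smul_eq_zero {u : M}
    (hu : ∀ j, x j • u = 0) :
    ∃ φ : (R ⧸ Ideal.span (Set.range x)) →ₗ[R] M, φ 1 = u := by
  refine ⟨Submodule.liftQ _ (LinearMap.toSpanSingleton R M u) ?_, ?_⟩
  · refine Ideal.span_le.2 ?_
    rintro _ ⟨j, rfl⟩
    simpa using hu j
  · change (1 : R) • u = u
    simp

lemma hom_quotient_ext {J : Ideal R}
    {φ ψ : (R ⧸ J) →ₗ[R] M} (h : φ 1 = ψ 1) : φ = ψ := by
  ext
  simpa using h

end Hom

/-! ### From Koszul cohomology to Ext -/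

section Ext

open CategoryTheory

variable {σ : Type} [LinearOrder σ] [Fintype σ] {R : Type u} [CommRing R] {x : σ → R}

/-- Elements of `E` killed by `J` are maps `R/J → E`. Multiplication by `a` is injective on `R/J`,
so the map `1 ↦ y` extends along it, and `u` is the image of `1`. -/
lemma exists_smul_eq_of_injective (E : Type u) [AddCommGroup E] [Module R E]
    [Module.Injective R E] {J : Ideal R} {a : R} (ha : ∀ r, a * r ∈ J → r ∈ J) {y : E}
    (hy : ∀ r ∈ J, r • y = 0) : ∃ u : E, a • u = y ∧ ∀ r ∈ J, r • u = 0 := by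
  let φ : (R ⧸ J) →ₗ[R] E := Submodule.liftQ J (LinearMap.toSpanSingleton R E y)
    fun r hr => by simpa using hy r hr
  have hinj : Function.Injective (LinearMap.lsmul R (R ⧸ J) a) := by
    refine (injective_iff_map_eq_zero _).2 fun r => ?_
    obtain ⟨r, rfl⟩ := Ideal.Quotient.mk_surjective r
    intro h
    exact Ideal.Quotient.eq_zero_iff_mem.2 (ha r (Ideal.Quotient.eq_zero_iff_mem.1 h))
  obtain ⟨h, hh⟩ := Module.Injective.extension_property R E (R ⧸ J) (R ⧸ J) _ hinj φ
  refine ⟨h 1, ?_, fun r hr => ?_⟩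
  · have h₁ : φ 1 = y := by
      change (1 : R) • y = y
      simp
    rw [← h₁, ← hh, LinearMap.comp_apply, LinearMap.lsmul_apply, map_smul]
  · rw [← map_smul, ← map_zero h]
    congr 1
    rw [Algebra.smul_def, mul_one]
    exact Ideal.Quotient.eq_zero_iff_mem.2 hr

lemma isAcyclic_of_injective
    (hx : ∀ (A : Finset σ) (a : σ), a ∉ A → ∀ r, x a * r ∈ Ideal.span (x '' A) →
      r ∈ Ideal.span (x '' A))
    (E : Type u) [AddCommGroup E] [Module R E] [Module.Injective R E] (i : ℕ) :
    IsAcyclic x (i + 1) E := by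
  intro z hz hd
  refine (exists_diff_eq_of_surjective (fun A a ha y hy => ?_) univ i z hz hd).imp
    fun w hw => ⟨by simpa using hw.1, hw.2⟩
  obtain ⟨u, hu, hu'⟩ := exists_smul_eq_of_injective E (hx A a ha) (y := y) fun r hr => by
    have : Ideal.span (x '' A) ≤ (Submodule.span R {y}).annihilator :=
      Ideal.span_le.2 (by
        rintro _ ⟨j, hj, rfl⟩
        simpa [Submodule.mem_annihilator_span_singleton] using hy j hj)
    simpa [Submodule.mem_annihilator_span_singleton] using this hr
  exact ⟨u, hu, fun j hj => hu' _ (Ideal.subset_span ⟨j, hj, rfl⟩)⟩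

/-- Vanishing of Koszul cohomology of `M` in degree `i` implies vanishing of
`Ext^i(R / (x), M)`, if `x` is a regular sequence in any order. -/
theorem subsingleton_ext_of_isAcyclic
    (hx : ∀ (A : Finset σ) (a : σ), a ∉ A → ∀ r, x a * r ∈ Ideal.span (x '' A) →
      r ∈ Ideal.span (x '' A))
    (i : ℕ) (M : ModuleCat.{u} R) (hM : IsAcyclic x i M) :
    Subsingleton (Abelian.Ext.{u} (ModuleCat.of R (R ⧸ Ideal.span (Set.range x))) M i) := by
  induction i generalizing M with
  | zero =>
    refine subsingleton_of_forall_eq 0 fun e => ?_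
    obtain ⟨φ, rfl⟩ := (Abelian.Ext.mk₀_bijective _ _).2 e
    rw [Abelian.Ext.mk₀_eq_zero_iff]
    refine ModuleCat.hom_ext (hom_quotient_ext ?_)
    obtain ⟨w, hw, hw'⟩ := hM _ (single_mem_supp univ (φ.hom 1))
      (diff_single_eq_zero_iff.2 fun j _ => smul_eq_zero_of_hom φ.hom j)
    -- No cardinality satisfies `· + 1 = 0`, so there are no cochains below degree `0`.
    have hw₀ : w = 0 := funext fun S => hw S (by simp)
    rw [hw₀, map_zero] at hw'
    simpa using (congrFun hw' ∅).symm
  | succ i ih =>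
    obtain ⟨E, hE, f, _⟩ := (inferInstance : EnoughInjectives (ModuleCat.{u} R)).presentation M
    have hE' : Module.Injective R E := Module.injective_module_of_injective_object R E
    let T := ShortComplex.mk f (Limits.cokernel.π f) (Limits.cokernel.condition f)
    have hT : T.ShortExact := { exact := ShortComplex.exact_cokernel f }
    have hf : Function.Injective T.f.hom := hT.moduleCat_injective_f
    have hg : Function.Surjective T.g.hom := hT.moduleCat_surjective_g
    have hfg : Function.Exact T.f.hom T.g.hom :=
      (ShortComplex.ShortExact.moduleCat_exact_iff_function_exact _).mp hT.1
    refine subsingleton_of_forall_eq 0 fun e => ?_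
    obtain ⟨e', rfl⟩ := Abelian.Ext.covariant_sequence_exact₁ _ hT e
      (Abelian.Ext.eq_zero_of_injective _) rfl
    -- Since `Ext^(i+1)` into `E` vanishes, `e` comes from `e'` in `Ext^i` into the cokernel. For `i
    -- = 0`, `H^0(E)` need not vanish, so the cokernel need not be acyclic; instead the map `φ`
    -- lifts to `E`, and the connecting map kills it.
    cases i with
    | zero =>
      obtain ⟨φ, rfl⟩ := (Abelian.Ext.mk₀_bijective _ _).2 e'
      obtain ⟨c, hc, hdc, hgc⟩ := exists_cocycle_lift hf hg hfg hM
        (single_mem_supp univ (φ.hom 1))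
        (diff_single_eq_zero_iff.2 fun j _ => smul_eq_zero_of_hom φ.hom j)
      rw [eq_single_of_mem_supp hc, diff_single_eq_zero_iff] at hdc
      obtain ⟨ψ, hψ⟩ := exists_hom_of_smul_eq_zero fun j => hdc j (mem_univ _)
      have hφ : φ = ModuleCat.ofHom ψ ≫ T.g := by
        refine ModuleCat.hom_ext (hom_quotient_ext ?_)
        have := congrFun hgc ∅
        rw [Pi.single_eq_same] at this
        rw [← this, ModuleCat.hom_comp, LinearMap.comp_apply, ModuleCat.hom_ofHom, hψ]
        rfl
      rw [hφ, ← Abelian.Ext.mk₀_comp_mk₀, Abelian.Ext.comp_assoc_of_second_deg_zero,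
        hT.comp_extClass, Abelian.Ext.comp_zero]
    | succ i =>
      have := ih T.X₃ (IsAcyclic.of_shortExact hf hg hfg hM (isAcyclic_of_injective hx E i))
      rw [Subsingleton.elim e' 0, Abelian.Ext.zero_comp]

end Ext

end Koszul

namespace Koszul

open Finset

/-! ### Koszul cohomology of `R/J` and regular elements -/

section Quotient

variable {σ : Type*} [LinearOrder σ] {R : Type*} [CommRing R]

/-- The Koszul cochains with values in an ideal. -/
def cochains (σ : Type*) (J : Ideal R) : Submodule R (Finset σ → R) :=
  Submodule.pi Set.univ fun _ => J

lemma mem_cochains {σ : Type*} {J : Ideal R} {z : Finset σ → R} :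
    z ∈ cochains σ J ↔ ∀ S, z S ∈ J := by
  simp [cochains]

lemma contr_mem_cochains {J : Ideal R} {z : Finset σ → R} (hz : z ∈ cochains σ J) (j : σ) :
    contr R R j z ∈ cochains σ J := by
  refine mem_cochains.2 fun S => ?_
  by_cases h : j ∈ S
  · rw [contr_apply_of_mem _ h]
    exact J.zero_mem
  · rw [contr_apply_of_notMem _ h]
    exact Submodule.smul_mem _ _ (mem_cochains.1 hz _)

lemma diff_mem_cochains {x : σ → R} {A : Finset σ} {J : Ideal R} {z : Finset σ → R}
    (hz : z ∈ cochains σ J) : diff R x A z ∈ cochains σ J := by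
  rw [diff_apply]
  refine Submodule.sum_mem _ fun j _ => Submodule.smul_mem _ _ (mem_cochains.2 fun S => ?_)
  rw [wedge_apply]
  split_ifs
  · exact Submodule.smul_mem _ _ (mem_cochains.1 hz _)
  · exact J.zero_mem

lemma mkQ_comp_eq_iff {σ : Type*} {J : Ideal R} {z w : Finset σ → R} :
    J.mkQ ∘ z = J.mkQ ∘ w ↔ z - w ∈ cochains σ J := by
  simp [mem_cochains, funext_iff, Ideal.Quotient.mk_eq_mk_iff_sub_mem]

lemma mkQ_comp_eq_zero_iff {σ : Type*} {J : Ideal R} {z : Finset σ → R} :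
    J.mkQ ∘ z = 0 ↔ z ∈ cochains σ J := by
  simp [mem_cochains, funext_iff, Ideal.Quotient.eq_zero_iff_mem]

lemma exists_eq_add_smul_of_mem_cochains {σ : Type*} [Fintype σ] {J : Ideal R}
    {f : R} {P : ℕ → Prop} {y : Finset σ → R}
    (hy : y ∈ cochains σ (J ⊔ Ideal.span {f})) (hys : y ∈ supp R R univ P) :
    ∃ u ∈ cochains σ J, ∃ v ∈ supp R R univ P, y = u + f • v := by
  have h (S : Finset σ) : ∃ v : R, y S - f * v ∈ J ∧ (y S = 0 → v = 0) := by
    by_cases hS : y S = 0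
    · exact ⟨0, by simp [hS]⟩
    · obtain ⟨a, ha, b, hb, hab⟩ := Submodule.mem_sup.1 (mem_cochains.1 hy S)
      obtain ⟨c, rfl⟩ := Ideal.mem_span_singleton'.1 hb
      exact ⟨c, by rw [← hab, mul_comm f, add_sub_cancel_right]; exact ha,
        fun h => absurd h hS⟩
  choose v hv hv' using h
  exact ⟨y - f • v, mem_cochains.2 fun S => by simpa using hv S, v,
    fun S hS => hv' S (hys S hS), by abel⟩

variable [Fintype σ] {x : σ → R}

lemma isAcyclic_quotient_iff {i : ℕ} {J : Ideal R} :
    IsAcyclic x i (R ⧸ J) ↔ ∀ z ∈ supp R R univ (· = i), diff R x univ z ∈ cochains σ J →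
      ∃ w ∈ supp R R univ (· + 1 = i), z - diff R x univ w ∈ cochains σ J := by
  constructor
  · intro h z hz hd
    obtain ⟨w, hw, hw'⟩ := h (J.mkQ ∘ z) (fun S hS => by simp [hz S hS])
      (by rw [diff_comp, mkQ_comp_eq_zero_iff.2 hd])
    obtain ⟨w, hws, rfl⟩ := exists_lift_mem_supp J.mkQ_surjective hw
    exact ⟨w, hws, mkQ_comp_eq_iff.1 (by rw [← hw', diff_comp])⟩
  · intro h z hz hd
    obtain ⟨z, hzs, rfl⟩ := exists_lift_mem_supp J.mkQ_surjective hz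
    rw [diff_comp, mkQ_comp_eq_zero_iff] at hd
    obtain ⟨w, hw, hw'⟩ := h z hzs hd
    exact ⟨J.mkQ ∘ w, fun S hS => by simp [hw S hS], by
      rw [diff_comp, mkQ_comp_eq_iff.2 hw']⟩

/-- Elements of the ideal generated by `x` act null-homotopically on the Koszul complex. -/
lemma exists_homotopy {f : R} (hf : f ∈ Ideal.span (Set.range x)) :
    ∃ H : (Finset σ → R) →ₗ[R] (Finset σ → R),
      (∀ z, diff R x univ (H z) + H (diff R x univ z) = f • z) ∧
      (∀ J, ∀ z ∈ cochains σ J, H z ∈ cochains σ J) ∧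
      ∀ i, ∀ z ∈ supp R R univ (· = i), H z ∈ supp R R univ (· + 1 = i) := by
  obtain ⟨g, rfl⟩ := Ideal.mem_span_range_iff_exists_fun.1 hf
  refine ⟨∑ j, g j • contr R R j, fun z => ?_, fun J z hz => ?_, fun i z hz => ?_⟩
  · simp only [LinearMap.sum_apply, LinearMap.smul_apply, map_sum, map_smul, ← sum_add_distrib,
      ← smul_add, diff_contr_add (mem_univ _), sum_smul, smul_smul]
  · rw [LinearMap.sum_apply]
    exact Submodule.sum_mem _ fun j _ => Submodule.smul_mem _ _ (contr_mem_cochains hz j)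
  · rw [LinearMap.sum_apply]
    exact Submodule.sum_mem _ fun j _ => Submodule.smul_mem _ _
      (supp_mono (contr_mem_supp hz fun _ h => h) (subset_univ _) fun _ h => h)

/-- If `f` is a nonzerodivisor modulo `J` lying in the ideal generated by `x`, then vanishing of
Koszul cohomology of `R / (J, f)` in degree `i - 1` implies that of `R / J` in degree `i`. -/
theorem isAcyclic_quotient_of_regular {J : Ideal R} {f : R}
    (hf : f ∈ Ideal.span (Set.range x)) (hreg : ∀ r, f * r ∈ J → r ∈ J) {i : ℕ}
    (h : ∀ l, l + 1 = i → IsAcyclic x l (R ⧸ (J ⊔ Ideal.span {f}))) :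
    IsAcyclic x i (R ⧸ J) := by
  rw [isAcyclic_quotient_iff]
  intro z hz hd
  obtain ⟨H, hH, hHJ, hHs⟩ := exists_homotopy hf
  set y := H z with hy
  have hys : y ∈ supp R R univ (· + 1 = i) := hHs i z hz
  have hdy : f • z - diff R x univ y ∈ cochains σ J := by
    rw [← hH z, add_sub_cancel_left]
    exact hHJ J _ hd
  -- Modulo `J`, `f • z` is the coboundary of `y`. If that is also `f` times the coboundary of `v`,
  -- then regularity cancels `f`.
  suffices ∃ v ∈ supp R R univ (· + 1 = i), diff R x univ y - f • diff R x univ v ∈ cochains σ J by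
    obtain ⟨v, hv, hv'⟩ := this
    refine ⟨v, hv, mem_cochains.2 fun S => hreg _ ?_⟩
    have := mem_cochains.1 (Submodule.add_mem _ hdy hv') S
    simpa [mul_sub] using this
  rcases i with _ | i
  · refine ⟨0, Submodule.zero_mem _, ?_⟩
    rw [show y = 0 from funext fun S => hys S (by simp)]
    simp
  · have hys' : y ∈ supp R R univ (· = i) := supp_mono hys subset_rfl (by simp)
    -- The coboundary of `y` is `f • z` modulo `J`, so `y` is a cocycle modulo `(J, f)`.
    obtain ⟨w, hw, hw'⟩ := isAcyclic_quotient_iff.1 (h i rfl) y hys' (mem_cochains.2 fun S => by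
      have h₁ := mem_cochains.1 hdy S
      have h₂ : f * z S ∈ Ideal.span {f} :=
        Ideal.mul_mem_right _ _ (Ideal.mem_span_singleton_self f)
      have := Submodule.sub_mem _ (Submodule.mem_sup_right (S := J) h₂)
        (Submodule.mem_sup_left (T := Ideal.span {f}) h₁)
      simpa using this)
    obtain ⟨u, hu, v, hv, huv⟩ := exists_eq_add_smul_of_mem_cochains hw'
      (Submodule.sub_mem _ hys' (diff_mem_supp hw fun _ h => h))
    refine ⟨v, supp_mono hv subset_rfl (by simp), ?_⟩
    have := congrArg (diff R x univ) huv
    rw [map_sub, diff_diff, sub_zero, map_add, map_smul] at this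
    rw [this, add_sub_cancel_right]
    exact diff_mem_cochains hu

end Quotient

end Koszul

/-! ### Initial ideals, monomial by monomial -/

namespace InitiallyRegular

open MvPolynomial

variable {k : Type u} [Field k] {n : ℕ}

lemma mem_ini_iff {ord : MonomialOrder.{0, v} (Fin n)} {I : Ideal (MvPolynomial (Fin n) k)}
    {p : MvPolynomial (Fin n) k} :
    p ∈ ini ord I ↔ ∀ a ∈ p.support, ∃ g ∈ I, g ≠ 0 ∧ ord.degree g ≤ a := by
  rw [ini, MonomialOrder.span_leadingTerm_eq_span_monomial',
    ← Set.image_image (fun s => monomial s 1) ord.degree, mem_ideal_span_monomial_image]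
  simp [and_assoc]

lemma monomial_mem_ini {ord : MonomialOrder.{0, v} (Fin n)} {I : Ideal (MvPolynomial (Fin n) k)}
    {g : MvPolynomial (Fin n) k} (hg : g ∈ I) {b : Fin n →₀ ℕ}
    (h : ∀ a, coeff a g ≠ 0 → ord.toSyn a ≤ ord.toSyn b) :
    monomial b (coeff b g) ∈ ini ord I := by
  by_cases hb : coeff b g = 0
  · simp [hb]
  refine mem_ini_iff.2 fun a ha => ⟨g, hg, ?_, ?_⟩
  · rintro rfl
    simp at hb
  · have hab : b = a := by
      by_contra hab
      simp [coeff_monomial, hab] at ha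
    have hle : ord.toSyn (ord.degree g) ≤ ord.toSyn b :=
      ord.degree_le_iff.2 fun c hc => h c (mem_support_iff.1 hc)
    rw [← hab, ord.toSyn.injective (hle.antisymm (ord.le_degree (mem_support_iff.2 hb)))]

/-- A nonzero term of `in(I)` is divisible by the leading monomial of some `g ∈ I`; multiplying `g`
by a term adjusts exponent and coefficient, as `k` is a field. -/
lemma exists_mem_of_mem_ini {ord : MonomialOrder.{0, v} (Fin n)}
    {I : Ideal (MvPolynomial (Fin n) k)} {b : Fin n →₀ ℕ} {c : k}
    (h : monomial b c ∈ ini ord I) :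
    ∃ g ∈ I, coeff b g = c ∧ ∀ a, coeff a g ≠ 0 → ord.toSyn a ≤ ord.toSyn b := by
  by_cases hc : c = 0
  · exact ⟨0, I.zero_mem, by simp [hc], by simp⟩
  obtain ⟨g, hg, hg₀, hgb⟩ := mem_ini_iff.1 h b (by simp [coeff_monomial, hc])
  obtain ⟨d, rfl⟩ := exists_add_of_le hgb
  have hlc : ord.leadingCoeff g ≠ 0 := ord.leadingCoeff_ne_zero_iff.2 hg₀
  refine ⟨g * monomial d (c / ord.leadingCoeff g), I.mul_mem_right _ hg, ?_, fun a ha => ?_⟩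
  · rw [coeff_mul_monomial]
    exact mul_div_cancel₀ c hlc
  · rw [coeff_mul_monomial'] at ha
    split_ifs at ha with hda
    · obtain ⟨e, rfl⟩ := exists_add_of_le hda
      rw [add_tsub_cancel_left] at ha
      rw [add_comm d e, map_add, map_add]
      gcongr
      exact ord.le_degree (mem_support_iff.2 (left_ne_zero_of_mul ha))
    · exact absurd rfl ha

lemma monomial_coeff_mem_ini {ord : MonomialOrder.{0, v} (Fin n)}
    {I : Ideal (MvPolynomial (Fin n) k)} {p : MvPolynomial (Fin n) k} (hp : p ∈ ini ord I)
    (b : Fin n →₀ ℕ) : monomial b (coeff b p) ∈ ini ord I := by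
  refine mem_ini_iff.2 fun a ha => mem_ini_iff.1 hp a ?_
  by_cases h : b = a
  · subst h
    simpa using ha
  · simp [coeff_monomial, h] at ha

/-! ### The multigrading and passage from `in(I)` to `I` -/

section Multidegree

open Finset Koszul

/-- The multidegree `∑ i ∉ S, e_i` of the Koszul generator indexed by `S`. -/
noncomputable def genDegree (S : Finset (Fin n)) : Fin n →₀ ℕ := ∑ i ∈ Sᶜ, Finsupp.single i 1

/-- Adding `j` to the index set lowers the generator's degree by exactly the degree of the factor
`x_j`. Grading by complements thus makes the differential homogeneous without negative shifts. -/
lemma genDegree_erase {j : Fin n} {T : Finset (Fin n)} (h : j ∈ T) :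
    genDegree (T.erase j) = Finsupp.single j 1 + genDegree T := by
  rw [genDegree, genDegree, compl_erase, sum_insert (by simpa using h)]

/-- The part of multidegree `γ` of a Koszul cochain. -/
noncomputable def part (γ : Fin n →₀ ℕ) (z : Finset (Fin n) → MvPolynomial (Fin n) k) :
    Finset (Fin n) → MvPolynomial (Fin n) k :=
  fun S => if genDegree S ≤ γ then
    monomial (γ - genDegree S) (coeff (γ - genDegree S) (z S)) else 0

lemma coeff_part (γ : Fin n →₀ ℕ) (z : Finset (Fin n) → MvPolynomial (Fin n) k)
    (S : Finset (Fin n)) (a : Fin n →₀ ℕ) :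
    coeff a (part γ z S) = if a + genDegree S = γ then coeff a (z S) else 0 := by
  rw [part]
  split_ifs with h₁ h₂ h₂
  · subst h₂
    simp
  · rw [coeff_monomial, if_neg]
    rintro rfl
    exact h₂ (tsub_add_cancel_of_le h₁)
  · exact absurd (h₂ ▸ le_add_self) h₁
  · simp

lemma part_apply_add (a : Fin n →₀ ℕ) (z : Finset (Fin n) → MvPolynomial (Fin n) k)
    (S : Finset (Fin n)) : part (a + genDegree S) z S = monomial a (coeff a (z S)) := by
  simp [part]

lemma part_sub (γ : Fin n →₀ ℕ) (z w : Finset (Fin n) → MvPolynomial (Fin n) k) :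
    part γ (z - w) = part γ z - part γ w := by
  ext S a
  simp only [coeff_part, Pi.sub_apply, coeff_sub]
  split_ifs <;> simp

lemma part_part (γ : Fin n →₀ ℕ) (z : Finset (Fin n) → MvPolynomial (Fin n) k) :
    part γ (part γ z) = part γ z := by
  ext S a
  simp only [coeff_part]
  split_ifs <;> rfl

lemma part_mem_supp {γ : Fin n →₀ ℕ} {z : Finset (Fin n) → MvPolynomial (Fin n) k}
    {A : Finset (Fin n)} {P : ℕ → Prop} (hz : z ∈ supp (MvPolynomial (Fin n) k) _ A P) :
    part γ z ∈ supp (MvPolynomial (Fin n) k) _ A P := by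
  intro S hS
  simp [part, hz S hS]

lemma X_smul_wedge_part (γ : Fin n →₀ ℕ) (z : Finset (Fin n) → MvPolynomial (Fin n) k)
    (j : Fin n) (T : Finset (Fin n)) (a : Fin n →₀ ℕ) :
    coeff a (((X j : MvPolynomial (Fin n) k) • wedge (MvPolynomial (Fin n) k) _ j (part γ z)) T) =
      if a + genDegree T = γ then
        coeff a (((X j : MvPolynomial (Fin n) k) • wedge (MvPolynomial (Fin n) k) _ j z) T) else 0 := by
  by_cases hj : j ∈ T
  swap
  · simp [wedge_apply, hj]
  have hs (p : MvPolynomial (Fin n) k) : coeff a (X j * (sgn _ j (T.erase j) * p)) =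
      (-1) ^ #{t ∈ T.erase j | t < j} * coeff a (X j * p) := by
    rw [mul_left_comm, sgn, ← coeff_C_mul]
    simp
  simp only [Pi.smul_apply, wedge_apply, if_pos hj, smul_eq_mul, hs, coeff_X_mul', coeff_part,
    genDegree_erase hj]
  by_cases ha : j ∈ a.support
  · have h : a - Finsupp.single j 1 + (Finsupp.single j 1 + genDegree T) = a + genDegree T := by
      rw [← add_assoc, tsub_add_cancel_of_le]
      exact Finsupp.single_le_iff.2 (Nat.one_le_iff_ne_zero.2 (Finsupp.mem_support_iff.1 ha))
    simp only [if_pos ha, h]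
    split_ifs <;> simp
  · simp [ha]

lemma diff_part (γ : Fin n →₀ ℕ) (z : Finset (Fin n) → MvPolynomial (Fin n) k) :
    diff (R := MvPolynomial (Fin n) k) _ X univ (part γ z) =
      part γ (diff (R := MvPolynomial (Fin n) k) _ X univ z) := by
  ext T a
  simp only [coeff_part, diff_apply, Finset.sum_apply, coeff_sum, X_smul_wedge_part]
  split_ifs <;> simp

lemma part_mem_cochains_ini {ord : MonomialOrder.{0, v} (Fin n)}
    {I : Ideal (MvPolynomial (Fin n) k)} {z : Finset (Fin n) → MvPolynomial (Fin n) k}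
    (hz : z ∈ cochains (Fin n) (ini ord I)) (γ : Fin n →₀ ℕ) :
    part γ z ∈ cochains (Fin n) (ini ord I) := by
  refine mem_cochains.2 fun S => ?_
  rw [part]
  split_ifs
  · exact monomial_coeff_mem_ini (mem_cochains.1 hz S) _
  · exact Ideal.zero_mem _

/-- All terms of the Koszul cochain `z` have multidegree at most `s`. -/
def DegreeLE (ord : MonomialOrder.{0, v} (Fin n)) (s : ord.syn)
    (z : Finset (Fin n) → MvPolynomial (Fin n) k) : Prop :=
  ∀ S a, coeff a (z S) ≠ 0 → ord.toSyn (a + genDegree S) ≤ s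

variable {ord : MonomialOrder.{0, v} (Fin n)} {s : ord.syn}
  {z w : Finset (Fin n) → MvPolynomial (Fin n) k}

lemma DegreeLE.sub (hz : DegreeLE ord s z) (hw : DegreeLE ord s w) : DegreeLE ord s (z - w) := by
  intro S a h
  by_cases ha : coeff a (z S) = 0
  · exact hw S a fun h' => h (by simp [ha, h'])
  · exact hz S a ha

lemma degreeLE_part (γ : Fin n →₀ ℕ) (z : Finset (Fin n) → MvPolynomial (Fin n) k) :
    DegreeLE ord (ord.toSyn γ) (part γ z) := by
  intro S a h
  rw [coeff_part] at h
  split_ifs at h with h'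
  · rw [h']
  · exact absurd rfl h

lemma DegreeLE.diff (hz : DegreeLE ord s z) :
    DegreeLE ord s (diff (R := MvPolynomial (Fin n) k) _ X univ z) := by
  intro S a h
  by_contra hlt
  have h₀ : part (a + genDegree S) z = 0 := by
    ext T b
    rw [coeff_part]
    split_ifs with hb
    · by_contra hb'
      exact hlt (hb ▸ hz T b hb')
    · simp
  have h₁ := congrArg (coeff a) (congrFun (diff_part (a + genDegree S) z) S)
  rw [h₀, map_zero, coeff_part, if_pos rfl] at h₁
  exact h (by simpa using h₁.symm)

lemma exists_degreeLE (ord : MonomialOrder.{0, v} (Fin n))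
    (z : Finset (Fin n) → MvPolynomial (Fin n) k) :
    ∃ s, DegreeLE ord s z ∧
      (z = 0 ∨ ∃ S a, coeff a (z S) ≠ 0 ∧ ord.toSyn (a + genDegree S) = s) := by
  by_cases hz : z = 0
  · exact ⟨0, fun S a h => by simp [hz] at h, Or.inl hz⟩
  obtain ⟨S, hS⟩ := Function.ne_iff.1 hz
  obtain ⟨a, ha⟩ := ne_zero_iff.1 hS
  obtain ⟨⟨S, a⟩, hm, hmax⟩ := exists_max_image (univ.sigma fun S => (z S).support)
    (fun p => ord.toSyn (p.2 + genDegree p.1)) ⟨⟨S, a⟩, by simpa using ha⟩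
  exact ⟨_, fun T b hb => hmax ⟨T, b⟩ (by simpa using hb), Or.inr ⟨S, a, by simpa using hm, rfl⟩⟩

/-- By translation invariance of the order, each component of the `γ`-part is zero or the leading
term of an element of `I`. -/
lemma part_mem_cochains_ini_of_degreeLE {I : Ideal (MvPolynomial (Fin n) k)} {γ : Fin n →₀ ℕ}
    (hz : DegreeLE ord (ord.toSyn γ) z) (hI : z ∈ cochains (Fin n) I) :
    part γ z ∈ cochains (Fin n) (ini ord I) := by
  refine mem_cochains.2 fun S => ?_
  rw [part]
  split_ifs with h
  · refine monomial_mem_ini (mem_cochains.1 hI S) fun a ha => ?_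
    have := hz S a ha
    rwa [← tsub_add_cancel_of_le h, map_add, map_add, add_le_add_iff_right] at this
  · exact Ideal.zero_mem _

lemma exists_lift_part {I : Ideal (MvPolynomial (Fin n) k)} {γ : Fin n →₀ ℕ}
    (hz : part γ z ∈ cochains (Fin n) (ini ord I)) {P : ℕ → Prop}
    (hzs : part γ z ∈ supp (MvPolynomial (Fin n) k) _ univ P) :
    ∃ g ∈ cochains (Fin n) I, g ∈ supp (MvPolynomial (Fin n) k) _ univ P ∧
      DegreeLE ord (ord.toSyn γ) g ∧ part γ g = part γ z := by
  have h (S : Finset (Fin n)) : ∃ p ∈ I, (part γ z S = 0 → p = 0) ∧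
      (∀ a, coeff a p ≠ 0 → ord.toSyn (a + genDegree S) ≤ ord.toSyn γ) ∧
      ∀ a, a + genDegree S = γ → coeff a p = coeff a (z S) := by
    by_cases hS : part γ z S = 0
    · refine ⟨0, I.zero_mem, fun _ => rfl, by simp, fun a ha => ?_⟩
      have := coeff_part γ z S a
      rw [if_pos ha, hS] at this
      exact this
    · have hle : genDegree S ≤ γ := by
        by_contra hle
        exact hS (by simp [part, hle])
      obtain ⟨b, rfl⟩ : ∃ b, γ = b + genDegree S := ⟨_, (tsub_add_cancel_of_le hle).symm⟩
      have hm := mem_cochains.1 hz S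
      rw [part_apply_add] at hm
      obtain ⟨g, hg, hgb, hga⟩ := exists_mem_of_mem_ini hm
      refine ⟨g, hg, fun h => absurd h hS, fun a ha => ?_, fun a ha => ?_⟩
      · rw [map_add, map_add]
        gcongr
        exact hga a ha
      · rw [add_right_cancel ha, hgb]
  choose g hgI hg₀ hgle hgγ using h
  refine ⟨g, mem_cochains.2 hgI, fun S hS => hg₀ S (hzs S hS), hgle, ?_⟩
  ext S a
  simp only [coeff_part]
  split_ifs with ha
  · exact hgγ S a ha
  · rfl

/-- Koszul cohomology of `R / in(I)` vanishing in degree `i` implies the same for `R / I`. -/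
theorem isAcyclic_of_ini {I : Ideal (MvPolynomial (Fin n) k)} {i : ℕ}
    (h : IsAcyclic (R := MvPolynomial (Fin n) k) X i (MvPolynomial (Fin n) k ⧸ ini ord I)) :
    IsAcyclic (R := MvPolynomial (Fin n) k) X i (MvPolynomial (Fin n) k ⧸ I) := by
  rw [isAcyclic_quotient_iff] at h ⊢
  -- Well-founded induction on a bound for the multidegrees of the terms.
  have key (s : ord.syn) : ∀ z ∈ supp (MvPolynomial (Fin n) k) _ univ (· = i), DegreeLE ord s z →
      Koszul.diff (R := MvPolynomial (Fin n) k) _ X univ z ∈ cochains (Fin n) I →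
      ∃ w ∈ supp (MvPolynomial (Fin n) k) _ univ (· + 1 = i),
        z - Koszul.diff (R := MvPolynomial (Fin n) k) _ X univ w ∈ cochains (Fin n) I := by
    induction s using WellFoundedLT.induction with
    | ind s ih =>
      intro z hz hzle hd
      obtain ⟨γ, rfl⟩ := ord.toSyn.surjective s
      obtain ⟨w, hw, hw'⟩ := h (part γ z) (part_mem_supp hz) (by
        rw [diff_part]
        exact part_mem_cochains_ini_of_degreeLE hzle.diff hd)
      -- As `in(I)` is a monomial ideal, `w` may be replaced by its part of multidegree `γ`.
      replace hw' := part_mem_cochains_ini hw' γ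
      rw [part_sub, part_part, ← diff_part, ← part_part γ w, diff_part, ← part_sub] at hw'
      have hws := part_mem_supp (γ := γ) hw
      have hdw : Koszul.diff (R := MvPolynomial (Fin n) k) _ X univ (part γ w) ∈
          supp (MvPolynomial (Fin n) k) _ univ (· = i) := diff_mem_supp hws fun _ h => h
      obtain ⟨g, hgI, hgs, hgle, hgγ⟩ :=
        exists_lift_part hw' (part_mem_supp (Submodule.sub_mem _ hz hdw))
      -- The correction by `g ∈ I` cancels the remaining `γ`-part, so all terms of `z'` lie strictly
      -- below `γ`.
      set z' := z - Koszul.diff (R := MvPolynomial (Fin n) k) _ X univ (part γ w) - g with hz'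
      have hz's : z' ∈ supp (MvPolynomial (Fin n) k) _ univ (· = i) :=
        Submodule.sub_mem _ (Submodule.sub_mem _ hz hdw) hgs
      have hz'γ : part γ z' = 0 := by rw [hz', part_sub, hgγ, sub_self]
      have hz'le : DegreeLE ord (ord.toSyn γ) z' :=
        (hzle.sub (degreeLE_part γ w).diff).sub hgle
      have hdz' : Koszul.diff (R := MvPolynomial (Fin n) k) _ X univ z' ∈ cochains (Fin n) I := by
        rw [hz', map_sub, map_sub, diff_diff, sub_zero]
        exact Submodule.sub_mem _ hd (diff_mem_cochains hgI)
      obtain ⟨w', hw's, hw'I⟩ : ∃ w' ∈ supp (MvPolynomial (Fin n) k) _ univ (· + 1 = i),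
          z' - Koszul.diff (R := MvPolynomial (Fin n) k) _ X univ w' ∈ cochains (Fin n) I := by
        obtain ⟨s, hs, h₀ | ⟨S, a, ha, rfl⟩⟩ := exists_degreeLE ord z'
        · exact ⟨0, Submodule.zero_mem _, by simp [h₀]⟩
        · refine ih _ (lt_of_le_of_ne (hz'le S a ha) fun heq => ha ?_) z' hz's hs hdz'
          have := coeff_part γ z' S a
          rw [if_pos (ord.toSyn.injective heq), hz'γ] at this
          simpa using this.symm
      refine ⟨part γ w + w', Submodule.add_mem _ hws hw's, ?_⟩
      have := Submodule.add_mem _ hw'I hgI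
      rw [hz'] at this
      convert this using 1
      rw [map_add]
      abel
  intro z hz hd
  obtain ⟨s, hs, -⟩ := exists_degreeLE ord z
  exact key s z hz hs hd

end Multidegree

/-! ### Induction along the initially regular sequence -/

lemma mem_of_isSMulRegular_quotient {R : Type*} [CommRing R] {J : Ideal R} {f r : R}
    (h : IsSMulRegular (R ⧸ J) f) (hr : f * r ∈ J) : r ∈ J := by
  refine Ideal.Quotient.eq_zero_iff_mem.1 (h ?_)
  change f • Ideal.Quotient.mk J r = f • 0
  rw [smul_zero]
  exact Ideal.Quotient.eq_zero_iff_mem.2 hr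

lemma mem_span_X_of_X_mul_mem (A : Finset (Fin n)) (a : Fin n) (ha : a ∉ A)
    (r : MvPolynomial (Fin n) k) (h : X a * r ∈ Ideal.span (X '' (A : Set (Fin n)))) :
    r ∈ Ideal.span (X '' (A : Set (Fin n))) := by
  rw [mem_ideal_span_X_image] at h ⊢
  intro m hm
  obtain ⟨j, hj, hjm⟩ := h (Finsupp.single a 1 + m) (by
    rw [mem_support_iff, coeff_X_mul]
    exact mem_support_iff.1 hm)
  refine ⟨j, hj, ?_⟩
  have : a ≠ j := fun h => ha (h ▸ hj)
  simpa [Finsupp.single_apply, this] using hjm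

/-- The Koszul cohomology of the quotients in an initially regular sequence vanishes in low
degrees. -/
lemma isAcyclic_iniSeq {q : ℕ} {I : Ideal (MvPolynomial (Fin n) k)}
    {ord : Fin q → MonomialOrder.{0, v} (Fin n)} {f : Fin q → MvPolynomial (Fin n) k}
    (hf : IsInitiallyRegular I ord f) (i j : ℕ) (hij : i + j < q) :
    Koszul.IsAcyclic (R := MvPolynomial (Fin n) k) X j
      (MvPolynomial (Fin n) k ⧸ iniSeq I ord f i
        (Nat.lt_of_le_of_lt (Nat.le_add_right i j) hij)) := by
  induction j generalizing i with
  | zero =>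
    obtain ⟨hm, hreg⟩ := hf.regular ⟨i, hij⟩
    exact Koszul.isAcyclic_quotient_of_regular hm
      (fun r hr => mem_of_isSMulRegular_quotient hreg hr) fun l hl => by simp at hl
  | succ j ih =>
    obtain ⟨hm, hreg⟩ := hf.regular ⟨i, by omega⟩
    refine Koszul.isAcyclic_quotient_of_regular hm
      (fun r hr => mem_of_isSMulRegular_quotient hreg hr) fun l hl => ?_
    obtain rfl : l = j := by omega
    -- The ideal at index `i + 1` is by definition the initial ideal of the `i`-th ideal plus `f i`.
    exact isAcyclic_of_ini (ih (i + 1) (by omega))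

end InitiallyRegular

theorem proposition2p2 {k : Type u} [Field k] {n q : ℕ} (I : Ideal (MvPolynomial (Fin n) k))
    (ord : Fin q → MonomialOrder.{0, v} (Fin n)) (f : Fin q → MvPolynomial (Fin n) k)
    (hf : InitiallyRegular.IsInitiallyRegular I ord f) :
    (q : ℕ∞) ≤ moduleDepth (MvPolynomial.idealOfVars (Fin n) k) (MvPolynomial (Fin n) k ⧸ I) := by
  refine le_sInf ?_
  rintro _ ⟨d, rfl, hd⟩
  by_contra hlt
  have hdq : d < q := by simpa using hlt
  refine not_subsingleton_iff_nontrivial.2 hd ?_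
  -- As `d < q`, index `0` exists, and its ideal is by definition `in(I)`.
  exact Koszul.subsingleton_ext_of_isAcyclic InitiallyRegular.mem_span_X_of_X_mul_mem d _
    (InitiallyRegular.isAcyclic_of_ini
      (InitiallyRegular.isAcyclic_iniSeq hf 0 d (by omega)))
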